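/- Let $R$ be a commutative noetherian ring with $1$ and let $I$ be an ideal of $R$. Write $\max(R)$ for the maximal spectrum of $R$ with the Zariski topology and $V(I)=\{\mathfrak m\in\max(R): I\subseteq\mathfrak m\}$. Let $n\ge 3$ and $d\ge 0$ be integers with $d\le 2n-3$, and suppose that $\max(R)$ is the disjoint union of $V(I)$ and of $V_1\cup\dots\cup V_k$, where $V_1,\dots,V_k\subseteq\max(R)$ are finitely many subsets (which may overlap), each of which is, in the subspace topology, a noetherian topological space of (Krull) dimension at most $d$. Let $\mathrm{Um}_n(R,I)$ be the set of rows $v=(v_1,\dots,v_n)\in R^n$ such that $v\cdot u^{t}=1$ for some $u\in R^n$ and $v\equiv(1,0,\dots,0)\pmod I$. Let $\mathrm E_n(R)\le\mathrm{GL}_n(R)$ be the subgroup generated by the elementary matrices $E_{ij}(\lambda)=I_n+\lambda e_{ij}$ ($i\ne j$, $\lambda\in R$), and let $\mathrm E_n(R,I)$ be the smallest normal subgroup of $\mathrm E_n(R)$ containing all $E_{21}(x)$ with $x\in I$. Then for all $v,w\in\mathrm{Um}_n(R,I)$ there are $\varepsilon_1,\varepsilon_2\in\mathrm E_n(R,I)$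 and $a,b,a_2,\dots,a_n\in R$ such that $$v\,\varepsilon_1=(a,a_2,a_3,\dots,a_n)\qquad\text{and}\qquad w\,\varepsilon_2=(b,a_2,a_3,\dots,a_n).$$ -/

import Mathlib

open scoped Matrix

/-- A row `v` of length `n` over `R` is unimodular if `v · wᵗ = 1` for some row `w`. -/
def IsUnimodularRow {R : Type*} [CommRing R] {n : ℕ} (v : Fin n → R) : Prop :=
  ∃ w : Fin n → R, v ⬝ᵥ w = 1

/-- `Um_n(R, I)`: the unimodular rows of length `n` that are congruent to `(1, 0, …, 0)` modulo
`I`. -/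
def Um {R : Type*} [CommRing R] (n : ℕ) (I : Ideal R) : Set (Fin n → R) :=
  {v | IsUnimodularRow v ∧ ∀ i : Fin n, v i - (if (i : ℕ) = 0 then 1 else 0) ∈ I}

/-- The elementary group `E_n(R)`: the subgroup of `GL_n(R)` generated by the elementary matrices
`E_{ij}(c) = 1 + c e_{ij}` with `i ≠ j` and `c ∈ R`. -/
def elemGroup (n : ℕ) (R : Type*) [CommRing R] : Subgroup (GL (Fin n) R) :=
  Subgroup.closure {g | ∃ i j : Fin n, i ≠ j ∧ ∃ c : R,
    (g : Matrix (Fin n) (Fin n) R) = Matrix.transvection i j c}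

/-- The relative elementary group `E_n(R, I)`: the smallest normal subgroup of `E_n(R)` that
contains the elementary matrices `E_{21}(x)` with `x ∈ I`, viewed as a subgroup of `GL_n(R)`.
(Coordinates are numbered from `0` in the code.) -/
def relElemGroup {R : Type*} [CommRing R] (n : ℕ) (I : Ideal R) : Subgroup (GL (Fin n) R) :=
  (Subgroup.normalClosure {g : elemGroup n R | ∃ i j : Fin n, (i : ℕ) = 1 ∧ (j : ℕ) = 0 ∧
    ∃ x ∈ I, ((g : GL (Fin n) R) : Matrix (Fin n) (Fin n) R) = Matrix.transvection i j x}).map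
      (elemGroup n R).subtype

/-- `V(I)` in the maximal spectrum: the set of the maximal ideals of `R` that contain `I`. -/
def maxZeroLocus {R : Type*} [CommRing R] (I : Ideal R) : Set (MaximalSpectrum R) :=
  {m | I ≤ m.asIdeal}

/-!
This is a Mennicke–Newman argument. It is enough to make the entries `v 0` and `w 0` comaximal by
relative elementary operations: if `α v₀ + β w₀ = 1` and `D` is the tail of `w` minus the tail of
`v`, then adding `v₀ α D` to the tail of `v` and `-w₀ β D` to the tail of `w` makes the tails equal.

The two tails have `2 (n - 1) > d` entries in total. Changing an entry of the tail of `v` by a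
suitable element of `I v₀`, or one of the tail of `w` by one of `I w₀`, lowers the dimension of the
common zero set outside the zero loci of `I`, `v₀` and `w₀`, so there the tails become comaximal.
Where `v₀` or `w₀` vanishes they are so by unimodularity. On `V(I)` both tails vanish; hence `v₀` is
first added to `v₁`, which amounts to conjugating the operations on `v` by `E₀₁(1)` and leaves `v₀`
alone. Once the tails are comaximal, adding combinations of their entries with coefficients in `I`
makes `v₀` and `w₀` comaximal.
-/

section GeneralPosition

open TopologicalSpace

theorem krullDim_add_one_le_of_strictMono {α β : Type*} [Preorder α] [Preorder β] {f : α → β}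
    (hf : StrictMono f) (h : ∀ a, ∃ b, f a < b) : Order.krullDim α + 1 ≤ Order.krullDim β := by
  cases isEmpty_or_nonempty α
  · rw [Order.krullDim_eq_bot, WithBot.bot_add]
    exact bot_le
  · rw [Order.krullDim_eq_iSup_height_of_nonempty, ← WithBot.coe_one, ← WithBot.coe_add,
      ENat.iSup_add]
    have : Nonempty β := .map f ‹_›
    rw [Order.krullDim_eq_iSup_height_of_nonempty, WithBot.coe_le_coe]
    refine iSup_le fun a => ?_
    obtain ⟨b, hb⟩ := h a
    calc Order.height a + 1 ≤ Order.height (f a) + 1 := by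
          gcongr; exact Order.height_le_height_apply_of_strictMono f hf a
      _ ≤ Order.height b := Order.height_add_one_le hb
      _ ≤ ⨆ b, Order.height b := le_iSup _ b

theorem topologicalKrullDim_inter_add_one_le {X : Type*} [TopologicalSpace X] {Y D : Set X}
    (hD : IsClosed D) (h : ∀ C ∈ irreducibleComponents Y, ¬ C ⊆ Subtype.val ⁻¹' D) :
    topologicalKrullDim ↥(Y ∩ D) + 1 ≤ topologicalKrullDim Y := by
  have hf : Topology.IsInducing (Set.inclusion (Set.inter_subset_left : Y ∩ D ⊆ Y)) :=
    (Topology.IsEmbedding.inclusion _).isInducing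
  refine krullDim_add_one_le_of_strictMono (IrreducibleCloseds.map_strictMono_of_isInducing hf)
    fun S => ?_
  obtain ⟨C, hC, hSC⟩ := exists_mem_irreducibleComponents_subset_of_isIrreducible _
    (S.map _ hf.continuous).isIrreducible
  have hSD : ((S.map _ hf.continuous : IrreducibleCloseds Y) : Set Y) ⊆ Subtype.val ⁻¹' D :=
    closure_minimal (by rintro _ ⟨y, -, rfl⟩; exact y.2.2) (hD.preimage continuous_subtype_val)
  exact ⟨⟨C, hC.1, isClosed_of_mem_irreducibleComponents C hC⟩, hSC,
    fun hCS => h C hC fun _ hx => hSD (hCS hx)⟩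

variable {R : Type*} [CommRing R]

theorem isClosed_setOf_mem_asIdeal (a : R) : IsClosed {m : MaximalSpectrum R | a ∈ m.asIdeal} := by
  simpa [Set.preimage, PrimeSpectrum.mem_zeroLocus, MaximalSpectrum.toPrimeSpectrum] using
    (PrimeSpectrum.isClosed_zeroLocus {a}).preimage MaximalSpectrum.toPrimeSpectrum_continuous

theorem exists_mem_add_notMem_of_finite {S : Set (MaximalSpectrum R)} (hS : S.Finite)
    {B : Ideal R} (hB : ∀ m ∈ S, ¬ B ≤ m.asIdeal) (a : R) :
    ∃ c ∈ B, ∀ m ∈ S, a + c ∉ m.asIdeal := by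
  have hcop : IsCoprime B (⨅ m ∈ hS.toFinset, m.asIdeal) :=
    Ideal.isCoprime_biInf fun m hm => Ideal.isCoprime_iff_sup_eq.2 <| by
      rw [sup_comm]
      exact m.isMaximal.out.2 _ (left_lt_sup.2 (hB m (hS.mem_toFinset.1 hm)))
  obtain ⟨b, hb, x, hx, hbx⟩ := hcop.exists
  simp only [Submodule.mem_iInf, hS.mem_toFinset] at hx
  refine ⟨b * (1 - a), B.mul_mem_right _ hb, fun m hm ham => ?_⟩
  refine m.isMaximal.ne_top ((Ideal.eq_top_iff_one _).2 ?_)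
  convert m.asIdeal.add_mem ham (m.asIdeal.mul_mem_right (1 - a) (hx m hm)) using 1
  linear_combination (a - 1) * hbx

theorem exists_mem_topologicalKrullDim_inter_add_one_le {ι : Type*} [Finite ι]
    (Y : ι → Set (MaximalSpectrum R)) [∀ k, NoetherianSpace (Y k)] {B : Ideal R}
    (hB : ∀ k, ∀ m ∈ Y k, ¬ B ≤ m.asIdeal) (a : R) :
    ∃ c ∈ B, ∀ k, topologicalKrullDim ↥(Y k ∩ {m | a + c ∈ m.asIdeal}) + 1 ≤
      topologicalKrullDim (Y k) := by
  have := fun k => (NoetherianSpace.finite_irreducibleComponents (α := Y k)).to_subtype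
  choose p hp using fun k (C : irreducibleComponents (Y k)) => C.2.1.nonempty
  obtain ⟨c, hcB, hc⟩ := exists_mem_add_notMem_of_finite
    (Set.finite_range fun x : Σ k, irreducibleComponents (Y k) => (p x.1 x.2).1)
    (by rintro _ ⟨x, rfl⟩; exact hB x.1 _ (p x.1 x.2).2) a
  exact ⟨c, hcB, fun k => topologicalKrullDim_inter_add_one_le (isClosed_setOf_mem_asIdeal _)
    fun C hC hCD => hc _ ⟨⟨k, C, hC⟩, rfl⟩ (hCD (hp k ⟨C, hC⟩))⟩

theorem exists_general_position {ι κ : Type*} [Finite ι] (s : Finset κ) (a : κ → R)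
    (B : κ → Ideal R) (Y : ι → Set (MaximalSpectrum R)) [∀ k, NoetherianSpace (Y k)]
    (hdim : ∀ k, topologicalKrullDim (Y k) < s.card)
    (hB : ∀ k, ∀ m ∈ Y k, ∀ i, ¬ B i ≤ m.asIdeal) :
    ∃ c : κ → R, (∀ i, c i ∈ B i) ∧ ∀ k, ∀ m ∈ Y k, ∃ i ∈ s, a i + c i ∉ m.asIdeal := by
  classical
  induction s using Finset.induction_on generalizing Y with
  | empty =>
    refine ⟨0, fun i => (B i).zero_mem, fun k m hm => ?_⟩
    have : Nonempty (IrreducibleCloseds (Y k)) := ⟨{⟨m, hm⟩}⟩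
    exact absurd (hdim k) (by simpa [topologicalKrullDim] using Order.krullDim_nonneg)
  | insert j s hj ih =>
    obtain ⟨e, heB, he⟩ := exists_mem_topologicalKrullDim_inter_add_one_le Y
      (fun k m hm => hB k m hm j) (a j)
    have (k : ι) : NoetherianSpace ↥(Y k ∩ {m | a j + e ∈ m.asIdeal}) := .inter_of_left _ _
    obtain ⟨c, hcB, hc⟩ := ih (fun k => Y k ∩ {m | a j + e ∈ m.asIdeal}) (fun k => by
        have := (he k).trans_lt (hdim k)
        rwa [Finset.card_insert_of_notMem hj, Nat.cast_succ, ENat.WithBot.lt_add_one_iff,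
          ENat.WithBot.add_one_le_natCast_iff] at this)
      (fun k m hm => hB k m hm.1)
    refine ⟨Function.update c j e, fun i => ?_, fun k m hm => ?_⟩
    · obtain rfl | hij := eq_or_ne i j
      · simpa using heB
      · simpa [hij] using hcB i
    · by_cases hmj : a j + e ∈ m.asIdeal
      · obtain ⟨i, hi, him⟩ := hc k m ⟨hm, hmj⟩
        have hij : i ≠ j := fun h => hj (h ▸ hi)
        exact ⟨i, Finset.mem_insert_of_mem hi, by simpa [hij] using him⟩
      · exact ⟨j, Finset.mem_insert_self j s, by simpa using hmj⟩

end GeneralPosition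

section Coprime

variable {R : Type*} [CommRing R]

theorem isCoprime_span_range_iff {κ : Type*} {a : κ → R} {I : Ideal R} :
    IsCoprime (Ideal.span (Set.range a)) I ↔
      ∀ m : MaximalSpectrum R, I ≤ m.asIdeal → ∃ i, a i ∉ m.asIdeal := by
  rw [Ideal.isCoprime_iff_sup_eq]
  refine ⟨fun h m hI => ?_, fun h => ?_⟩
  · by_contra! ha
    refine m.isMaximal.ne_top (top_unique (h ▸ sup_le (Ideal.span_le.2 ?_) hI))
    exact Set.range_subset_iff.2 ha
  · by_contra hne
    obtain ⟨m, hm, hle⟩ := Ideal.exists_le_maximal _ hne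
    obtain ⟨i, hi⟩ := h ⟨m, hm⟩ (le_sup_right.trans hle)
    exact hi (hle (Ideal.mem_sup_left (Ideal.subset_span ⟨i, rfl⟩)))

theorem isCoprime_span_range_add {κ : Type*} {a c : κ → R} {I : Ideal R} (hc : ∀ i, c i ∈ I)
    (ha : IsCoprime (Ideal.span (Set.range a)) I) :
    IsCoprime (Ideal.span (Set.range (a + c))) I := by
  rw [isCoprime_span_range_iff] at ha ⊢
  intro m hI
  obtain ⟨i, hi⟩ := ha m hI
  exact ⟨i, by rwa [Pi.add_apply, m.asIdeal.add_mem_iff_left (hI (hc i))]⟩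

theorem exists_isCoprime_span_range_add_smul {α β ι : Type*} [Fintype α] [Fintype β] [Finite ι]
    {I : Ideal R} {d : ℕ} (hd : d < Fintype.card α + Fintype.card β)
    (V : ι → Set (MaximalSpectrum R)) (hV : (maxZeroLocus I)ᶜ ⊆ ⋃ k, V k)
    (hnoeth : ∀ k, TopologicalSpace.NoetherianSpace (V k))
    (hdim : ∀ k, topologicalKrullDim (V k) ≤ (d : WithBot ℕ∞)) {x : α → R} {y : β → R} {s t : R}
    (hx : IsCoprime (Ideal.span (Set.range x)) (I * Ideal.span {s}))
    (hy : IsCoprime (Ideal.span (Set.range y)) (Ideal.span {t})) :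
    ∃ (b : α → R) (c : β → R), (∀ i, b i ∈ I) ∧ (∀ j, c j ∈ I) ∧
      IsCoprime (Ideal.span (Set.range (x + s • b))) (Ideal.span (Set.range (y + t • c))) := by
  let Y (k : ι) : Set (MaximalSpectrum R) :=
    V k ∩ {m | ¬ I ≤ m.asIdeal ∧ s ∉ m.asIdeal ∧ t ∉ m.asIdeal}
  have hYnoeth (k : ι) : TopologicalSpace.NoetherianSpace (Y k) := .inter_of_left _ _
  have hYdim (k : ι) : topologicalKrullDim (Y k) < (Finset.univ : Finset (α ⊕ β)).card := by
    refine ((Topology.IsEmbedding.inclusion Set.inter_subset_left).isInducing.topologicalKrullDim_le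
      |>.trans (hdim k)).trans_lt ?_
    rw [Finset.card_univ, Fintype.card_sum]
    exact_mod_cast hd
  obtain ⟨e, he, hpos⟩ := exists_general_position Finset.univ (Sum.elim x y)
    (Sum.elim (fun _ => I * Ideal.span {s}) fun _ => I * Ideal.span {t}) Y hYdim (by
      rintro k m ⟨-, hI, hs, ht⟩ (i | j) <;>
        simp [m.isMaximal.isPrime.mul_le, hI, hs, ht])
  choose b hbI hb using fun i => Ideal.mem_mul_span_singleton.1 (he (Sum.inl i))
  choose c hcI hc using fun j => Ideal.mem_mul_span_singleton.1 (he (Sum.inr j))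
  refine ⟨b, c, hbI, hcI, isCoprime_span_range_iff.2 fun m hym => ?_⟩
  rw [isCoprime_span_range_iff] at hx hy
  replace hym (j : β) : y j + t * c j ∈ m.asIdeal := hym (Ideal.subset_span ⟨j, rfl⟩)
  have ht : t ∉ m.asIdeal := fun ht => by
    obtain ⟨j, hj⟩ := hy m (Ideal.span_singleton_le_iff_mem _ |>.2 ht)
    exact hj ((m.asIdeal.add_mem_iff_left (m.asIdeal.mul_mem_right _ ht)).1 (hym j))
  by_cases hIs : I * Ideal.span {s} ≤ m.asIdeal
  · obtain ⟨i, hi⟩ := hx m hIs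
    have hsb : s * b i ∈ m.asIdeal :=
      hIs (mul_comm s (b i) ▸ Ideal.mul_mem_mul (hbI i) (Ideal.mem_span_singleton_self s))
    exact ⟨i, by simpa [m.asIdeal.add_mem_iff_left hsb] using hi⟩
  · rw [m.isMaximal.isPrime.mul_le, not_or, Ideal.span_singleton_le_iff_mem] at hIs
    obtain ⟨k, hk⟩ := Set.mem_iUnion.1 (hV (show m ∈ (maxZeroLocus I)ᶜ from hIs.1))
    obtain ⟨i | j, -, hij⟩ := hpos k m ⟨hk, hIs.1, hIs.2, ht⟩
    · exact ⟨i, by simpa [← hb, mul_comm] using hij⟩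
    · exact absurd (hym j) (by simpa [← hc, mul_comm] using hij)

theorem exists_isCoprime_span_singleton_add {I J K : Ideal R} (hJI : IsCoprime J I)
    (hJK : IsCoprime J K) {y : R} (hy : IsCoprime (Ideal.span {y}) I) :
    ∃ k ∈ I * K, IsCoprime (Ideal.span {y + k}) (I * J) := by
  obtain ⟨e, he, k, hk, hek⟩ := (hJI.mul_right hJK).exists
  obtain ⟨_, hr, f, hf, hrf⟩ := hy.exists
  obtain ⟨r, rfl⟩ := Ideal.mem_span_singleton'.1 hr
  refine ⟨k * (1 - y), Ideal.mul_mem_right _ _ hk, .mul_right ?_ ?_⟩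
  · refine Ideal.isCoprime_iff_exists.2 ⟨r * (y + k * (1 - y)),
      Ideal.mem_span_singleton'.2 ⟨r, rfl⟩, f - k * (r * (1 - y)),
      I.sub_mem hf (I.mul_mem_right _ (Ideal.mul_le_left hk)), ?_⟩
    linear_combination hrf
  · refine Ideal.isCoprime_iff_exists.2 ⟨_, Ideal.mem_span_singleton_self _, e * (1 - y),
      J.mul_mem_right _ he, ?_⟩
    linear_combination (1 - y) * hek

theorem exists_isCoprime_add_mem {J : Ideal R} (x : R) {y : R}
    (hy : IsCoprime (Ideal.span {y}) J) : ∃ j ∈ J, IsCoprime (x + j) y := by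
  obtain ⟨_, hs, j, hj, hsj⟩ := hy.exists
  obtain ⟨s, rfl⟩ := Ideal.mem_span_singleton'.1 hs
  refine ⟨j * (1 - x), J.mul_mem_right _ hj, 1, s * (1 - x), ?_⟩
  linear_combination (1 - x) * hsj

end Coprime

section ElementaryGroup

open Matrix
open scoped commutatorElement

/-- The elementary matrix `E_{ij}(c) = 1 + c e_{ij}` as an element of the general linear group. -/
def elemGL {κ R : Type*} [Fintype κ] [DecidableEq κ] [CommRing R] {i j : κ} (h : i ≠ j) (c : R) :
    GL κ R :=
  (SpecialLinearGroup.transvection h c : SpecialLinearGroup κ R)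

section Transvection

variable {κ R : Type*} [Fintype κ] [DecidableEq κ] [CommRing R]

theorem coe_elemGL {i j : κ} (h : i ≠ j) (c : R) :
    (elemGL h c).val = transvection i j c := rfl

theorem elemGL_inv {i j : κ} (h : i ≠ j) (c : R) : (elemGL h c)⁻¹ = elemGL h (-c) := by
  rw [elemGL, elemGL, ← SpecialLinearGroup.transvection_inv, map_inv]

theorem commutatorElement_elemGL {i j k : κ} (hij : i ≠ j) (hjk : j ≠ k) (hik : i ≠ k) (a b : R) :
    ⁅elemGL hij a, elemGL hjk b⁆ = elemGL hik (a * b) := by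
  rw [commutatorElement_def, elemGL_inv, elemGL_inv]
  ext1
  simp only [Units.val_mul, coe_elemGL, transvection]
  simp [mul_add, add_mul, hij.symm, hjk.symm, hik.symm, ← single_neg]
  abel

theorem vecMul_elemGL {i j : κ} (h : i ≠ j) (c : R) (v : κ → R) :
    v ᵥ* (elemGL h c).val = v + Pi.single j (v i * c) := by
  rw [coe_elemGL, transvection, vecMul_add, vecMul_one]
  congr 1
  ext k
  obtain rfl | hk := eq_or_ne j k
  · simp [vecMul, dotProduct, single_apply]
  · simp [vecMul, dotProduct, hk, hk.symm]

end Transvection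

variable {R : Type*} [CommRing R] {I : Ideal R} {n : ℕ}

theorem elemGL_mem_elemGroup {i j : Fin n} (h : i ≠ j) (c : R) : elemGL h c ∈ elemGroup n R :=
  Subgroup.subset_closure ⟨i, j, h, c, rfl⟩

theorem conj_mem_relElemGroup {g e : GL (Fin n) R} (hg : g ∈ relElemGroup n I)
    (he : e ∈ elemGroup n R) : e * g * e⁻¹ ∈ relElemGroup n I := by
  obtain ⟨x, hx, rfl⟩ := hg
  exact ⟨_, Subgroup.normalClosure_normal.conj_mem x hx ⟨e, he⟩, rfl⟩

theorem elemGL_mem_relElemGroup_of_row {i j k : Fin n} (hij : i ≠ j) (hik : i ≠ k) (hjk : j ≠ k)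
    {x : R} (h : elemGL hjk x ∈ relElemGroup n I) : elemGL hik x ∈ relElemGroup n I := by
  rw [← one_mul x, ← commutatorElement_elemGL hij hjk hik 1 x, commutatorElement_def]
  exact mul_mem (conj_mem_relElemGroup h (elemGL_mem_elemGroup hij 1)) (inv_mem h)

theorem elemGL_mem_relElemGroup_of_col {i j k : Fin n} (hjk : j ≠ k) (hik : i ≠ k) (hij : i ≠ j)
    {x : R} (h : elemGL hij x ∈ relElemGroup n I) : elemGL hik x ∈ relElemGroup n I := by
  rw [← mul_one x, ← commutatorElement_elemGL hij hjk hik x 1, commutatorElement_def, mul_assoc,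
    mul_assoc, ← mul_assoc (elemGL hjk 1)]
  exact mul_mem h (conj_mem_relElemGroup (inv_mem h) (elemGL_mem_elemGroup hjk 1))

theorem elemGL_mem_relElemGroup {i j : Fin (n + 3)} (h : i ≠ j) {x : R} (hx : x ∈ I) :
    elemGL h x ∈ relElemGroup (n + 3) I := by
  have mem_one_zero : elemGL (one_ne_zero : (1 : Fin (n + 3)) ≠ 0) x ∈ relElemGroup (n + 3) I :=
    ⟨⟨_, elemGL_mem_elemGroup _ x⟩,
      Subgroup.subset_normalClosure ⟨1, 0, rfl, rfl, x, hx, rfl⟩, rfl⟩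
  have mem_zero {k : Fin (n + 3)} (hk : k ≠ 0) : elemGL hk x ∈ relElemGroup (n + 3) I := by
    obtain rfl | hk1 := eq_or_ne k 1
    · exact mem_one_zero
    · exact elemGL_mem_relElemGroup_of_row hk1 hk _ mem_one_zero
  have mem_of_ne_zero {k l : Fin (n + 3)} (hk : k ≠ 0) (hkl : k ≠ l) :
      elemGL hkl x ∈ relElemGroup (n + 3) I := by
    obtain rfl | hl := eq_or_ne l 0
    · exact mem_zero hkl
    · exact elemGL_mem_relElemGroup_of_col hl.symm hkl hk (mem_zero hk)
  obtain rfl | hi := eq_or_ne i 0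
  · obtain ⟨k, hk, hkj⟩ := Fin.exists_ne_and_ne_of_two_lt 0 j (by omega)
    exact elemGL_mem_relElemGroup_of_row hk.symm h hkj (mem_of_ne_zero hk hkj)
  · exact mem_of_ne_zero hi h

theorem exists_vecMul_eq_vecCons_add_smul {c : Fin (n + 2) → R} (hc : ∀ i, c i ∈ I) :
    ∃ ε ∈ relElemGroup (n + 3) I, ∀ u : Fin (n + 3) → R,
      u ᵥ* ε.val = vecCons (u 0) (vecTail u + u 0 • c) := by
  rw [← Finset.univ_sum_single c]
  refine Finset.sum_induction _ (fun c => ∃ ε ∈ relElemGroup (n + 3) I, ∀ u : Fin (n + 3) → R,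
    u ᵥ* ε.val = vecCons (u 0) (vecTail u + u 0 • c))
    ?_ ⟨1, one_mem _, fun u => ?_⟩ fun i _ => ?_
  · rintro a b ⟨A, hA, hAu⟩ ⟨B, hB, hBu⟩
    refine ⟨A * B, mul_mem hA hB, fun u => ?_⟩
    rw [Units.val_mul, ← vecMul_vecMul, hAu, hBu, cons_val_zero, tail_cons, smul_add, add_assoc]
  · simp only [smul_zero, add_zero, Units.val_one, vecMul_one]
    exact (cons_head_tail u).symm
  · refine ⟨elemGL i.succ_ne_zero.symm (c i), elemGL_mem_relElemGroup _ (hc i), fun u => ?_⟩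
    rw [vecMul_elemGL]
    ext j
    cases j using Fin.cases <;> simp [vecTail, Pi.single_apply]

theorem exists_vecMul_eq_vecCons_add_dotProduct {c : Fin (n + 2) → R} (hc : ∀ i, c i ∈ I) :
    ∃ ε ∈ relElemGroup (n + 3) I, ∀ u : Fin (n + 3) → R,
      u ᵥ* ε.val = vecCons (u 0 + vecTail u ⬝ᵥ c) (vecTail u) := by
  rw [← Finset.univ_sum_single c]
  refine Finset.sum_induction _ (fun c => ∃ ε ∈ relElemGroup (n + 3) I, ∀ u : Fin (n + 3) → R,
    u ᵥ* ε.val = vecCons (u 0 + vecTail u ⬝ᵥ c) (vecTail u))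
    ?_ ⟨1, one_mem _, fun u => ?_⟩ fun i _ => ?_
  · rintro a b ⟨A, hA, hAu⟩ ⟨B, hB, hBu⟩
    refine ⟨A * B, mul_mem hA hB, fun u => ?_⟩
    rw [Units.val_mul, ← vecMul_vecMul, hAu, hBu, cons_val_zero, tail_cons, dotProduct_add,
      add_assoc]
  · simp only [dotProduct_zero, add_zero, Units.val_one, vecMul_one]
    exact (cons_head_tail u).symm
  · refine ⟨elemGL i.succ_ne_zero (c i), elemGL_mem_relElemGroup _ (hc i), fun u => ?_⟩
    rw [vecMul_elemGL]
    ext j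
    cases j using Fin.cases <;> simp [vecTail]

theorem relElemGroup_le_ker_map (n : ℕ) (I : Ideal R) :
    relElemGroup n I ≤ (GeneralLinearGroup.map (n := Fin n) (Ideal.Quotient.mk I)).ker := by
  rw [relElemGroup, Subgroup.map_le_iff_le_comap]
  refine Subgroup.normalClosure_le_normal ?_
  rintro g ⟨i, j, -, -, x, hx, hg⟩
  ext a b
  simp [hg, transvection, one_apply, single_apply, apply_ite (Ideal.Quotient.mk I),
    Ideal.Quotient.eq_zero_iff_mem.2 hx]

theorem vecMul_sub_mem_of_mem_relElemGroup {ε : GL (Fin n) R} (hε : ε ∈ relElemGroup n I)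
    (v : Fin n → R) (i : Fin n) : (v ᵥ* ε.val) i - v i ∈ I := by
  have hmap : ε.val.map (Ideal.Quotient.mk I) = 1 :=
    congrArg Units.val (relElemGroup_le_ker_map n I hε)
  rw [← Ideal.Quotient.eq, RingHom.map_vecMul, hmap, vecMul_one, Function.comp_apply]

theorem IsUnimodularRow.vecMul {v : Fin n → R} (hv : IsUnimodularRow v) (g : GL (Fin n) R) :
    IsUnimodularRow (v ᵥ* g.val) := by
  obtain ⟨u, hu⟩ := hv
  refine ⟨(g⁻¹).val *ᵥ u, ?_⟩
  rw [dotProduct_mulVec, vecMul_vecMul, ← Units.val_mul, mul_inv_cancel, Units.val_one, vecMul_one,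
    hu]

theorem vecMul_mem_Um {v : Fin n → R} (hv : v ∈ Um n I) {ε : GL (Fin n) R}
    (hε : ε ∈ relElemGroup n I) : v ᵥ* ε.val ∈ Um n I :=
  ⟨hv.1.vecMul ε, fun i => by
    simpa using I.add_mem (vecMul_sub_mem_of_mem_relElemGroup hε v i) (hv.2 i)⟩

end ElementaryGroup

section Rows

open Matrix

variable {R : Type*} [CommRing R] {I : Ideal R} {n : ℕ}

theorem exists_dotProduct_eq_of_mem_mul_span {κ : Type*} [Fintype κ] {a : κ → R} {y : R}
    (hy : y ∈ I * Ideal.span (Set.range a)) : ∃ c : κ → R, (∀ i, c i ∈ I) ∧ a ⬝ᵥ c = y := by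
  rw [← smul_eq_mul, Ideal.span, Submodule.mem_ideal_smul_span_iff_exists_sum] at hy
  obtain ⟨c, hc, rfl⟩ := hy
  refine ⟨c, hc, ?_⟩
  rw [Finsupp.sum_fintype c _ fun i => zero_smul R (a i)]
  exact dotProduct_comm _ _

theorem IsUnimodularRow.isCoprime_vecTail {x : Fin (n + 1) → R} (hx : IsUnimodularRow x) :
    IsCoprime (Ideal.span (Set.range (vecTail x))) (Ideal.span {x 0}) := by
  obtain ⟨u, hu⟩ := hx
  rw [dotProduct, Fin.sum_univ_succ, add_comm] at hu
  exact Ideal.isCoprime_iff_exists.2 ⟨_, Ideal.sum_mem _ fun i _ => Ideal.mul_mem_right _ _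
    (Ideal.subset_span ⟨i, rfl⟩), _, Ideal.mul_mem_right _ _ (Ideal.mem_span_singleton_self _), hu⟩

theorem exists_isCoprime_vecMul_of_isCoprime_vecTail {x w : Fin (n + 3) → R}
    (hxI : IsCoprime (Ideal.span (Set.range (vecTail x))) I)
    (hxw : IsCoprime (Ideal.span (Set.range (vecTail x))) (Ideal.span (Set.range (vecTail w))))
    (hwI : IsCoprime (Ideal.span {w 0}) I) :
    ∃ A ∈ relElemGroup (n + 3) I, ∃ B ∈ relElemGroup (n + 3) I,
      IsCoprime ((x ᵥ* A.val) 0) ((w ᵥ* B.val) 0) := by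
  obtain ⟨k, hk, hwk⟩ := exists_isCoprime_span_singleton_add hxI hxw hwI
  obtain ⟨j, hj, hjk⟩ := exists_isCoprime_add_mem (x 0) hwk
  obtain ⟨b, hb, rfl⟩ := exists_dotProduct_eq_of_mem_mul_span hj
  obtain ⟨c, hc, rfl⟩ := exists_dotProduct_eq_of_mem_mul_span hk
  obtain ⟨A, hA, hxA⟩ := exists_vecMul_eq_vecCons_add_dotProduct hb
  obtain ⟨B, hB, hwB⟩ := exists_vecMul_eq_vecCons_add_dotProduct hc
  exact ⟨A, hA, B, hB, by simpa only [hxA, hwB, cons_val_zero] using hjk⟩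

theorem exists_vecTail_vecMul_eq {v w : Fin (n + 3) → R}
    (hvw : ∀ i, (vecTail w - vecTail v) i ∈ I) (h : IsCoprime (v 0) (w 0)) :
    ∃ ε₁ ∈ relElemGroup (n + 3) I, ∃ ε₂ ∈ relElemGroup (n + 3) I,
      vecTail (v ᵥ* ε₁.val) = vecTail (w ᵥ* ε₂.val) := by
  obtain ⟨α, β, hαβ⟩ := h
  obtain ⟨ε₁, hε₁, hv⟩ := exists_vecMul_eq_vecCons_add_smul (c := α • (vecTail w - vecTail v))
    fun i => I.mul_mem_left _ (hvw i)
  obtain ⟨ε₂, hε₂, hw⟩ := exists_vecMul_eq_vecCons_add_smul (c := -β • (vecTail w - vecTail v))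
    fun i => I.mul_mem_left _ (hvw i)
  refine ⟨ε₁, hε₁, ε₂, hε₂, ?_⟩
  rw [hv, hw, tail_cons, tail_cons]
  ext i
  simp only [Pi.add_apply, Pi.smul_apply, Pi.sub_apply, smul_eq_mul]
  linear_combination (vecTail w i - vecTail v i) * hαβ

variable {ι : Type*} [Finite ι] {d : ℕ} (hd : d < 2 * (n + 2)) {V : ι → Set (MaximalSpectrum R)}
  (hV : (maxZeroLocus I)ᶜ ⊆ ⋃ k, V k) (hnoeth : ∀ k, TopologicalSpace.NoetherianSpace (V k))
  (hdim : ∀ k, topologicalKrullDim (V k) ≤ (d : WithBot ℕ∞))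

include hd hV hnoeth hdim

theorem exists_isCoprime_vecMul {x w : Fin (n + 3) → R}
    (hx : IsCoprime (Ideal.span (Set.range (vecTail x))) (I * Ideal.span {x 0}))
    (hw : IsCoprime (Ideal.span (Set.range (vecTail w))) (Ideal.span {w 0}))
    (hwI : IsCoprime (Ideal.span {w 0}) I) :
    ∃ A ∈ relElemGroup (n + 3) I, ∃ B ∈ relElemGroup (n + 3) I,
      IsCoprime ((x ᵥ* A.val) 0) ((w ᵥ* B.val) 0) := by
  obtain ⟨b, c, hb, hc, hbc⟩ := exists_isCoprime_span_range_add_smul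
    (by simpa [two_mul] using hd) V hV hnoeth hdim hx hw
  have hxI : IsCoprime (Ideal.span (Set.range (vecTail x + x 0 • b))) I :=
    isCoprime_span_range_add (fun i => I.mul_mem_left _ (hb i)) hx.of_mul_right_left
  obtain ⟨A, hA, hxA⟩ := exists_vecMul_eq_vecCons_add_smul hb
  obtain ⟨B, hB, hwB⟩ := exists_vecMul_eq_vecCons_add_smul hc
  obtain ⟨A', hA', B', hB', hAB⟩ := exists_isCoprime_vecMul_of_isCoprime_vecTail
    (x := vecCons (x 0) (vecTail x + x 0 • b)) (w := vecCons (w 0) (vecTail w + w 0 • c))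
    (by rwa [tail_cons]) (by rwa [tail_cons, tail_cons]) (by rwa [cons_val_zero])
  refine ⟨A * A', mul_mem hA hA', B * B', mul_mem hB hB', ?_⟩
  rwa [Units.val_mul, Units.val_mul, ← vecMul_vecMul, ← vecMul_vecMul, hxA, hwB]

theorem exists_isCoprime_vecMul_of_mem_Um {v w : Fin (n + 3) → R} (hv : v ∈ Um (n + 3) I)
    (hw : w ∈ Um (n + 3) I) :
    ∃ ε₁ ∈ relElemGroup (n + 3) I, ∃ ε₂ ∈ relElemGroup (n + 3) I,
      IsCoprime ((v ᵥ* ε₁.val) 0) ((w ᵥ* ε₂.val) 0) := by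
  let E : GL (Fin (n + 3)) R := elemGL zero_ne_one 1
  let x : Fin (n + 3) → R := v ᵥ* E.val
  have hxI : IsCoprime (Ideal.span (Set.range (vecTail x))) I := by
    have hx1 : x 1 = v 1 + v 0 := by simp [x, E, vecMul_elemGL]
    refine Ideal.isCoprime_iff_exists.2 ⟨x 1, Ideal.subset_span ⟨0, rfl⟩, -(v 1 + (v 0 - 1)),
      I.neg_mem (I.add_mem (by simpa using hv.2 1) (by simpa using hv.2 0)), ?_⟩
    rw [hx1]
    ring
  have hwI : IsCoprime (Ideal.span {w 0}) I :=
    Ideal.isCoprime_iff_exists.2 ⟨_, Ideal.mem_span_singleton_self _, -(w 0 - 1),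
      I.neg_mem (by simpa using hw.2 0), by ring⟩
  obtain ⟨A, hA, B, hB, hAB⟩ := exists_isCoprime_vecMul hd hV hnoeth hdim
    (hxI.mul_right (hv.1.vecMul E).isCoprime_vecTail) hw.1.isCoprime_vecTail hwI
  refine ⟨E * A * E⁻¹, conj_mem_relElemGroup hA (elemGL_mem_elemGroup _ _), B, hB, ?_⟩
  have hvA : (v ᵥ* (E * A * E⁻¹).val) 0 = (x ᵥ* A.val) 0 := by
    rw [Units.val_mul, Units.val_mul, ← vecMul_vecMul, ← vecMul_vecMul, elemGL_inv, vecMul_elemGL]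
    simp [x]
  rwa [hvA]

theorem exists_vecTail_vecMul_eq_of_mem_Um {v w : Fin (n + 3) → R} (hv : v ∈ Um (n + 3) I)
    (hw : w ∈ Um (n + 3) I) :
    ∃ ε₁ ∈ relElemGroup (n + 3) I, ∃ ε₂ ∈ relElemGroup (n + 3) I,
      vecTail (v ᵥ* ε₁.val) = vecTail (w ᵥ* ε₂.val) := by
  obtain ⟨A, hA, B, hB, hAB⟩ := exists_isCoprime_vecMul_of_mem_Um hd hV hnoeth hdim hv hw
  obtain ⟨P, hP, Q, hQ, hPQ⟩ := exists_vecTail_vecMul_eq (I := I) (fun i => by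
    simpa [vecTail] using I.sub_mem ((vecMul_mem_Um hw hB).2 i.succ)
      ((vecMul_mem_Um hv hA).2 i.succ)) hAB
  refine ⟨A * P, mul_mem hA hP, B * Q, mul_mem hB hQ, ?_⟩
  rwa [Units.val_mul, Units.val_mul, ← vecMul_vecMul, ← vecMul_vecMul]

end Rows

theorem mainTheorem10_general {R : Type*} [CommRing R] (I : Ideal R) (n d : ℕ)
    (hn : 3 ≤ n) (hd : d ≤ 2 * n - 3)
    {ι : Type*} [Finite ι] (V : ι → Set (MaximalSpectrum R))
    (hV : (maxZeroLocus I)ᶜ ⊆ ⋃ i, V i)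
    (hnoeth : ∀ i, TopologicalSpace.NoetherianSpace (V i))
    (hdim : ∀ i, topologicalKrullDim (V i) ≤ (d : WithBot ℕ∞))
    (v w : Fin n → R) (hv : v ∈ Um n I) (hw : w ∈ Um n I) :
    ∃ ε₁ ∈ relElemGroup n I, ∃ ε₂ ∈ relElemGroup n I, ∃ (a b : R) (t : Fin n → R),
      (∀ i : Fin n, (v ᵥ* (ε₁ : Matrix (Fin n) (Fin n) R)) i = if (i : ℕ) = 0 then a else t i) ∧
      (∀ i : Fin n, (w ᵥ* (ε₂ : Matrix (Fin n) (Fin n) R)) i = if (i : ℕ) = 0 then b else t i) := by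
  obtain ⟨n, rfl⟩ := Nat.exists_eq_add_of_le' hn
  obtain ⟨ε₁, hε₁, ε₂, hε₂, htail⟩ :=
    exists_vecTail_vecMul_eq_of_mem_Um (by omega) hV hnoeth hdim hv hw
  exact ⟨ε₁, hε₁, ε₂, hε₂, _, _, v ᵥ* ε₁.val,
    Fin.cases rfl fun i => rfl, Fin.cases rfl fun i => (congrFun htail i).symm⟩

theorem mainTheorem10 {R : Type*} [CommRing R] [IsNoetherianRing R] (I : Ideal R) (n d : ℕ)
    (hn : 3 ≤ n) (hd : d ≤ 2 * n - 3)
    {ι : Type*} [Finite ι] (V : ι → Set (MaximalSpectrum R))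
    (hV : (⋃ i, V i) = (maxZeroLocus I)ᶜ)
    (hnoeth : ∀ i, TopologicalSpace.NoetherianSpace (V i))
    (hdim : ∀ i, topologicalKrullDim (V i) ≤ (d : WithBot ℕ∞))
    (v w : Fin n → R) (hv : v ∈ Um n I) (hw : w ∈ Um n I) :
    ∃ ε₁ ∈ relElemGroup n I, ∃ ε₂ ∈ relElemGroup n I, ∃ (a b : R) (t : Fin n → R),
      (∀ i : Fin n, (v ᵥ* (ε₁ : Matrix (Fin n) (Fin n) R)) i = if (i : ℕ) = 0 then a else t i) ∧
      (∀ i : Fin n, (w ᵥ* (ε₂ : Matrix (Fin n) (Fin n) R)) i = if (i : ℕ) = 0 then b else t i) :=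
  mainTheorem10_general I n d hn hd V hV.ge hnoeth hdim v w hv hw
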